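/- Let $D:[0,1]\to(0,\infty)$ be continuous, and write $D$ also for the multiplication operator $(Df)(t)=D(t)f(t)$ on the real Hilbert space $L^2[0,1]$. Let $K:[0,1]^2\to\mathbb R$ be continuous and symmetric, and write $K$ also for the integral operator $(Kf)(t)=\int_0^1K(t,s)f(s)\,ds$. Suppose that the operator $$O=D(\mathbf I+K)D$$ is positive definite, i.e. $\langle f,Of\rangle>0$ for all $f\neq0$ in $L^2[0,1]$ (this holds, for example, whenever the kernel $K$ is positive semidefinite). Let $$d(K)=\sum_{m=0}^\infty\frac1{m!}\int_{[0,1]^m}\det\big[K(x_p,x_q)\big]_{p,q=1}^m\,dx_1\cdots dx_m$$ be the Fredholm determinant of $K$. For $n\ge1$ put $t_i=\frac{i-1/2}{n}$, $i=1,\dots,n$, and define the $n\times n$ matrices $$(M_n)_{ij}=\tfrac1nD(t_i)K(t_i,t_j)D(t_j)+D(t_i)^2\,1_{i=j},\qquad (R_n)_{ij}=\tfrac1nK(t_i,t_j)+1_{i=j},\qquad (S_n)_{ij}=D(t_i)\,1_{i=j}.$$ Let $y_n\in\mathbb R^n$ be vectors whose entries are bounded by a constant that does not depend on $n$, and let $f_n\in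 L^2[0,1]$ be the piecewise-constant function with $f_n(t)=(y_n)_i$ for $t\in(\frac{i-1}n,\frac in)$. Let $$l_n(f)=\langle f,O^{-1}f\rangle+2\int_0^1\log D(t)\,dt+\tfrac1n\log d(K).$$ Then $O$ has a bounded inverse, the series $d(K)$ converges and $d(K)>0$, $M_n=S_nR_nS_n$ for all $n$, $M_n$ is positive definite for all sufficiently large $n$, and as $n\to\infty$ $$\tfrac1n\big(y_n^{\top}M_n^{-1}y_n+\log\det M_n\big)-l_n(f_n)\longrightarrow0 .$$ In detail, \begin{align*} \tfrac1n\,y_n^{\top}M_n^{-1}y_n-\langle f_n,O^{-1}f_n\rangle&\longrightarrow0,\\ \det R_n\longrightarrow d(K),\qquad \log\det R_n&\longrightarrow\log d(K),\\ \tfrac1n\log\det S_n&\longrightarrow\int_0^1\log D(t)\,dt . \end{align*} -/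

import Mathlib

open MeasureTheory Filter Topology
open scoped unitInterval ENNReal

noncomputable section

namespace FunctionalLikelihood

/-- The real Hilbert space `L²[0,1]` (Lebesgue measure on the unit interval). -/
abbrev L2 : Type := Lp ℝ 2 (volume : Measure I)

/-- The multiplication operator `(D f)(t) = D(t) f(t)` on `L²[0,1]`. -/
def mulOp (D : C(I, ℝ)) : L2 →L[ℝ] L2 :=
  (ContinuousLinearMap.mul ℝ ℝ).holderL volume ∞ 2 2 (ContinuousMap.toLp ∞ volume ℝ D)

theorem mulOp_ae (D : C(I, ℝ)) (f : L2) : mulOp D f =ᵐ[volume] fun t => D t * f t := by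
  have h1 : mulOp D f =ᵐ[volume] fun t => (ContinuousMap.toLp ∞ volume ℝ D : Lp ℝ ∞ _) t * f t :=
    ContinuousLinearMap.coeFn_holder (r := 2) (ContinuousLinearMap.mul ℝ ℝ)
      (ContinuousMap.toLp ∞ volume ℝ D : Lp ℝ ∞ (volume : Measure I)) f
  have h2 := ContinuousMap.coeFn_toLp (p := ∞) (𝕜 := ℝ) (volume : Measure I) D
  filter_upwards [h1, h2] with t h1 h2
  rw [h1, h2]

theorem integrable_coe (f : L2) : Integrable (f : I → ℝ) volume :=
  (Lp.memLp f).integrable (by norm_num)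

theorem integrable_kernel_mul (k : C(I × I, ℝ)) (f : L2) (t : I) :
    Integrable (fun s => k (t, s) * f s) volume := by
  refine (integrable_coe f).bdd_mul (c := ‖k‖) ?_ ?_
  · exact (k.continuous.comp (by fun_prop : Continuous fun s : I => (t, s))).aestronglyMeasurable
  · exact Eventually.of_forall fun s => k.norm_coe_le_norm _

theorem continuous_integral_kernel_mul (k : C(I × I, ℝ)) (f : L2) :
    Continuous fun t : I => ∫ s, k (t, s) * f s := by
  refine continuous_of_dominated (bound := fun s => ‖k‖ * ‖f s‖)
    (fun t => (integrable_kernel_mul k f t).aestronglyMeasurable) ?_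
    ((integrable_coe f).norm.const_mul _) ?_
  · intro t
    filter_upwards with s
    rw [norm_mul]
    gcongr
    exact k.norm_coe_le_norm _
  · filter_upwards with s
    exact (k.continuous.comp (by fun_prop : Continuous fun t : I => (t, s))).mul continuous_const

/-- The continuous function `t ↦ ∫₀¹ k(t,s) f(s) ds`. -/
def intFun (k : C(I × I, ℝ)) (f : L2) : C(I, ℝ) :=
  ⟨fun t => ∫ s, k (t, s) * f s, continuous_integral_kernel_mul k f⟩

theorem norm_intFun_le (k : C(I × I, ℝ)) (f : L2) : ‖intFun k f‖ ≤ ‖k‖ * ‖f‖ := by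
  have h1 : ∫ s, ‖f s‖ ≤ ‖f‖ := by
    have h := eLpNorm_le_eLpNorm_of_exponent_le (p := 1) (q := 2) (μ := (volume : Measure I))
      (by norm_num) (Lp.aestronglyMeasurable f)
    rw [Lp.norm_def, integral_norm_eq_lintegral_enorm (Lp.aestronglyMeasurable f),
      ← eLpNorm_one_eq_lintegral_enorm]
    exact ENNReal.toReal_mono (Lp.eLpNorm_ne_top f) h
  refine (ContinuousMap.norm_le _ (by positivity)).2 fun t => ?_
  calc ‖∫ s, k (t, s) * f s‖ ≤ ∫ s, ‖k‖ * ‖f s‖ := by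
        refine norm_integral_le_of_norm_le ((integrable_coe f).norm.const_mul _) ?_
        filter_upwards with s
        rw [norm_mul]
        gcongr
        exact k.norm_coe_le_norm _
    _ = ‖k‖ * ∫ s, ‖f s‖ := integral_const_mul _ _
    _ ≤ ‖k‖ * ‖f‖ := by gcongr

/-- `intFun` as a bounded linear map `L²[0,1] → C[0,1]`. -/
def intFunL (k : C(I × I, ℝ)) : L2 →L[ℝ] C(I, ℝ) :=
  LinearMap.mkContinuous
    { toFun := intFun k
      map_add' := by
        intro f g
        ext t
        change ∫ s, k (t, s) * (f + g : L2) s = (∫ s, k (t, s) * f s) + ∫ s, k (t, s) * g s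
        rw [← integral_add (integrable_kernel_mul k f t) (integrable_kernel_mul k g t)]
        refine integral_congr_ae ?_
        filter_upwards [Lp.coeFn_add f g] with s hs
        rw [hs, Pi.add_apply, mul_add]
      map_smul' := by
        intro c f
        ext t
        change ∫ s, k (t, s) * (c • f : L2) s = c * ∫ s, k (t, s) * f s
        rw [← integral_const_mul]
        refine integral_congr_ae ?_
        filter_upwards [Lp.coeFn_smul c f] with s hs
        rw [hs, Pi.smul_apply, smul_eq_mul]
        ring }
    ‖k‖ (norm_intFun_le k)

/-- The integral operator `(K f)(t) = ∫₀¹ k(t,s) f(s) ds` on `L²[0,1]`. -/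
def intOp (k : C(I × I, ℝ)) : L2 →L[ℝ] L2 :=
  (ContinuousMap.toLp 2 volume ℝ).comp (intFunL k)

theorem intOp_ae (k : C(I × I, ℝ)) (f : L2) :
    intOp k f =ᵐ[volume] fun t => ∫ s, k (t, s) * f s :=
  ContinuousMap.coeFn_toLp (p := 2) (𝕜 := ℝ) (volume : Measure I) (intFun k f)

/-- The operator `O = D (I + K) D`. -/
def covOp (D : C(I, ℝ)) (k : C(I × I, ℝ)) : L2 →L[ℝ] L2 :=
  mulOp D * (1 + intOp k) * mulOp D

/-- The `m`-th term of the Fredholm series: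
`(1/m!) ∫_{[0,1]^m} det [k(x_p, x_q)]_{p,q=1}^m dx`. -/
def fredholmTerm (k : C(I × I, ℝ)) (m : ℕ) : ℝ :=
  (1 / (m.factorial : ℝ)) *
    ∫ x : Fin m → I, (Matrix.of fun p q : Fin m => k (x p, x q)).det

/-- The Fredholm determinant `d(K)` of the integral operator with kernel `k`. -/
def fredholmDet (k : C(I × I, ℝ)) : ℝ := ∑' m : ℕ, fredholmTerm k m

/-- The grid midpoint `(i - 1/2)/n` for `i = 1, …, n`; with indices starting at `0` this is
`(i + 1/2)/n`. -/
def midpt (n : ℕ) (i : Fin n) : I :=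
  ⟨((i : ℝ) + 1 / 2) / n, by
    have h1 : ((i : ℕ) : ℝ) + 1 ≤ n := by exact_mod_cast i.isLt
    have h0 : (0 : ℝ) ≤ ((i : ℕ) : ℝ) := Nat.cast_nonneg _
    exact ⟨by positivity, div_le_one_of_le₀ (by linarith) (by linarith)⟩⟩

/-- `(M_n)_{ij} = (1/n) D(t_i) k(t_i,t_j) D(t_j) + D(t_i)² 1_{i=j}`. -/
def matM (D : C(I, ℝ)) (k : C(I × I, ℝ)) (n : ℕ) : Matrix (Fin n) (Fin n) ℝ :=
  Matrix.of fun i j =>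
    1 / (n : ℝ) * D (midpt n i) * k (midpt n i, midpt n j) * D (midpt n j) +
      if i = j then D (midpt n i) ^ 2 else 0

/-- `(R_n)_{ij} = (1/n) k(t_i,t_j) + 1_{i=j}`. -/
def matR (k : C(I × I, ℝ)) (n : ℕ) : Matrix (Fin n) (Fin n) ℝ :=
  Matrix.of fun i j => 1 / (n : ℝ) * k (midpt n i, midpt n j) + if i = j then 1 else 0

/-- `(S_n)_{ij} = D(t_i) 1_{i=j}`. -/
def matS (D : C(I, ℝ)) (n : ℕ) : Matrix (Fin n) (Fin n) ℝ :=
  Matrix.of fun i j => if i = j then D (midpt n i) else 0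

/-- The open cell `((i-1)/n, i/n)`, `i = 1, …, n` (indices starting at `0`). -/
def cell (n : ℕ) (i : Fin n) : Set I := {t : I | (i : ℝ) / n < (t : ℝ) ∧ (t : ℝ) < ((i : ℝ) + 1) / n}

theorem measurableSet_cell (n : ℕ) (i : Fin n) : MeasurableSet (cell n i) :=
  (measurableSet_lt measurable_const measurable_subtype_coe).inter
    (measurableSet_lt measurable_subtype_coe measurable_const)

/-- The piecewise-constant embedding of a vector of length `n` in `L²[0,1]`: the function equal
to `y i` on the `i`-th cell. -/
def embed {n : ℕ} (y : Fin n → ℝ) : L2 :=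
  ∑ i : Fin n, indicatorConstLp 2 (measurableSet_cell n i) (measure_ne_top volume _) (y i)

/-- The quadratic form `⟨f, O⁻¹ f⟩` of the functional log-likelihood. `Ring.inverse O` is the
two-sided bounded inverse when `O` is invertible. -/
def quadForm (D : C(I, ℝ)) (k : C(I × I, ℝ)) (f : L2) : ℝ :=
  inner ℝ f (Ring.inverse (covOp D k) f)

/-- The corrected functional log-likelihood
`⟨f, O⁻¹ f⟩ + 2 ∫₀¹ log D(t) dt + (1/n) log d(K)`. -/
def functionalLogLik (D : C(I, ℝ)) (k : C(I × I, ℝ)) (n : ℕ) (f : L2) : ℝ :=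
  quadForm D k f + 2 * (∫ t, Real.log (D t)) + 1 / (n : ℝ) * Real.log (fredholmDet k)

end FunctionalLikelihood

end

open FunctionalLikelihood

/-! Since `M_n = S_n R_n S_n`, everything reduces to comparing `R_n` with `1 + K`; the factors `S_n`
contribute a Riemann sum for `∫ log D` and replace `y_n` by `S_n⁻¹ y_n`, which approximates `D⁻¹
f_n`.

Operator side: `D` is invertible and self-adjoint, so `1 + K` inherits positivity from `O`. As `K`
is compact (`isCompactOperator_intOp`), the Fredholm alternative makes `1 + K` invertible, and
symmetry with positivity upgrades this to `⟨f, (1 + K) f⟩ ≥ c ‖f‖²` (`exists_coercive_of_isUnit`).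
The embedding of vectors as step functions is an isometry up to the factor `n^(-1/2)`, and it
intertwines `R_n` with `1 + K` up to a small relative error, uniform over vectors
(`eventually_norm_one_add_intOp_embed_sub_le`). Hence `R_n` is eventually coercive with constant `c
/ 2`, and its inverse quadratic forms converge (`tendsto_quadForm_matR`).

Determinant side: `det R_n` expands into principal minors, whose sum of order `m` is a Riemann sum
for the `m`-th Fredholm term; Hadamard's inequality dominates the series uniformly in `n`
(`tendsto_det_matR`). Strict positivity of the limit needs a lower bound free of `n`: coercivity
bounds `det R_n` below through the traces of `R_n - 1` and its square, which stay bounded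
(`exp_le_det_matR`). -/

namespace FunctionalLikelihood

/-! ### Determinants: Hadamard bound, expansion in minors, lower bound. -/

section LinearAlgebra

/-- Hadamard's inequality for a real matrix with entries bounded by `B`. -/
theorem abs_det_le_of_entries {m : ℕ} (A : Matrix (Fin m) (Fin m) ℝ) {B : ℝ} (hB : 0 ≤ B)
    (hA : ∀ i j, |A i j| ≤ B) : |A.det| ≤ (B * √m) ^ m := by
  have : Fact (Module.finrank ℝ (EuclideanSpace ℝ (Fin m)) = m) := ⟨by simp⟩
  let b := EuclideanSpace.basisFun (Fin m) ℝ
  let v : Fin m → EuclideanSpace ℝ (Fin m) := fun i => WithLp.toLp 2 (A i)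
  have h1 : |b.toBasis.det v| = |A.det| := by
    rw [Module.Basis.det_apply, ← Matrix.det_transpose A]
    congr 2
  -- The volume form is the determinant up to sign, and is at most the product of the row norms.
  have h2 := (b.toBasis.orientation).abs_volumeForm_apply_le v
  rw [Orientation.volumeForm_robust' _ b, h1] at h2
  refine h2.trans ?_
  have h3 : ∀ i, ‖v i‖ ≤ B * √m := fun i => by
    rw [EuclideanSpace.norm_eq]
    refine Real.sqrt_le_iff.2 ⟨by positivity, ?_⟩
    rw [mul_pow, Real.sq_sqrt (Nat.cast_nonneg m)]
    calc ∑ j, ‖v i j‖ ^ 2 ≤ ∑ _j : Fin m, B ^ 2 := by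
          refine Finset.sum_le_sum fun j _ => ?_
          have : ‖v i j‖ ≤ B := hA i j
          gcongr
      _ = B ^ 2 * m := by simp [mul_comm]
  calc ∏ i, ‖v i‖ ≤ ∏ _i : Fin m, (B * √m) :=
        Finset.prod_le_prod (fun _ _ => norm_nonneg _) fun i _ => h3 i
    _ = _ := by simp

/-- From `m ^ m ≤ e ^ m * m!`, the half power `√m ^ m` costs only `√(m!)`, so the terms are at most
`(B √e) ^ m / √(m!)`, to which the ratio test applies. -/
theorem summable_hadamard_bound (B : ℝ) (hB : 0 ≤ B) :
    Summable fun m : ℕ => 1 / (m.factorial : ℝ) * (B * √m) ^ m := by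
  have hs : Summable fun m : ℕ => (B * √(Real.exp 1)) ^ m / √(m.factorial : ℝ) := by
    rcases hB.eq_or_lt with rfl | hB
    · refine summable_of_ne_finset_zero (s := {0}) fun m hm => ?_
      have : m ≠ 0 := by simpa using hm
      simp [this]
    refine summable_of_ratio_test_tendsto_lt_one (l := 0) one_pos
      (Eventually.of_forall fun m => by positivity) ?_
    have : ∀ m : ℕ, ‖(B * √(Real.exp 1)) ^ (m + 1) / √((m + 1).factorial : ℝ)‖ /
        ‖(B * √(Real.exp 1)) ^ m / √(m.factorial : ℝ)‖ = B * √(Real.exp 1) / √((m : ℝ) + 1) := by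
      intro m
      rw [Real.norm_of_nonneg (by positivity), Real.norm_of_nonneg (by positivity),
        Nat.factorial_succ, Nat.cast_mul, Real.sqrt_mul (by positivity), pow_succ]
      push_cast
      field_simp
    simp_rw [this]
    refine Tendsto.div_atTop tendsto_const_nhds ?_
    exact Real.tendsto_sqrt_atTop.comp
      (tendsto_atTop_add_const_right _ _ tendsto_natCast_atTop_atTop)
  refine Summable.of_nonneg_of_le (fun m => by positivity) (fun m => ?_) hs
  have h1 : (m : ℝ) ^ m ≤ Real.exp m * m.factorial := by
    have := Real.pow_div_factorial_le_exp (m : ℝ) (by positivity) m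
    rwa [div_le_iff₀ (by positivity)] at this
  have h2 : √(m : ℝ) ^ m ≤ √(Real.exp 1) ^ m * √(m.factorial : ℝ) := by
    refine (sq_le_sq₀ (by positivity) (by positivity)).1 ?_
    rw [mul_pow, pow_right_comm, pow_right_comm (√(Real.exp 1)), Real.sq_sqrt (by positivity),
      Real.sq_sqrt (by positivity), Real.sq_sqrt (by positivity), ← Real.exp_nat_mul, mul_one]
    exact h1
  have hf : (0:ℝ) < √(m.factorial : ℝ) := Real.sqrt_pos.2 (by positivity)
  rw [mul_pow, mul_pow, le_div_iff₀ hf]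
  calc 1 / (m.factorial : ℝ) * (B ^ m * √(m : ℝ) ^ m) * √(m.factorial : ℝ)
      ≤ 1 / (m.factorial : ℝ) * (B ^ m * (√(Real.exp 1) ^ m * √(m.factorial : ℝ))) *
        √(m.factorial : ℝ) := by gcongr
    _ = 1 / (m.factorial : ℝ) * (√(m.factorial : ℝ) * √(m.factorial : ℝ)) *
        (B ^ m * √(Real.exp 1) ^ m) := by ring
    _ = B ^ m * √(Real.exp 1) ^ m := by
        rw [Real.mul_self_sqrt (by positivity)]; field_simp

/-- Multilinearity in the rows: choosing rows of `M` on `s` and identity rows elsewhere leaves the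
principal minor on `s`. -/
theorem det_one_add_eq_sum_minors {ι R : Type*} [Fintype ι] [DecidableEq ι] [CommRing R]
    (M : Matrix ι ι R) :
    (1 + M).det = ∑ s : Finset ι, (M.submatrix (Subtype.val : s → ι) Subtype.val).det := by
  have h := (Matrix.detRowAlternating (R := R) (n := ι)).map_add_univ M.row (1 : Matrix ι ι R).row
  rw [add_comm]
  refine Eq.trans h (Finset.sum_congr rfl fun s _ => ?_)
  exact Matrix.det_piecewise_one_eq_submatrix_det M s

/-- Non-injective tuples repeat a row and contribute zero. Injective ones are grouped by image; each
`m`-set arises from `m!` bijections, all with the same minor because rows and columns are permuted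
together. -/
theorem sum_det_submatrix_eq {ι R : Type*} [Fintype ι] [DecidableEq ι] [CommRing R]
    (M : Matrix ι ι R) (m : ℕ) :
    ∑ x : Fin m → ι, (M.submatrix x x).det =
      m.factorial * ∑ s ∈ Finset.univ.powersetCard m,
        (M.submatrix (Subtype.val : s → ι) Subtype.val).det := by
  have h0 : ∑ x : Fin m → ι, (M.submatrix x x).det =
      ∑ x : Fin m → ι with Finset.univ.image x ∈ Finset.univ.powersetCard m,
        (M.submatrix x x).det := by
    refine (Finset.sum_filter_of_ne fun x _ hx => ?_).symm
    have hinj : Function.Injective x := by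
      by_contra hne
      simp only [Function.Injective, not_forall] at hne
      obtain ⟨a, b, hab, hne⟩ := hne
      exact hx (Matrix.det_zero_of_row_eq hne (by ext j; simp [hab]))
    simp [Finset.mem_powersetCard, Finset.card_image_of_injective _ hinj]
  rw [h0, Finset.mul_sum,
    ← Finset.sum_fiberwise_of_maps_to (t := Finset.univ.powersetCard m)
      (g := fun x : Fin m → ι => Finset.univ.image x) (by simp)]
  refine Finset.sum_congr rfl fun s hs => ?_
  have hcard : s.card = m := (Finset.mem_powersetCard.1 hs).2
  have h1 : ∑ e : Fin m ≃ s, (M.submatrix (fun p => (e p : ι)) (fun p => (e p : ι))).det =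
      m.factorial * (M.submatrix (Subtype.val : s → ι) Subtype.val).det := by
    have : ∀ e : Fin m ≃ s, (M.submatrix (fun p => (e p : ι)) (fun p => (e p : ι))).det =
        (M.submatrix (Subtype.val : s → ι) Subtype.val).det := fun e =>
      Matrix.det_submatrix_equiv_self e (M.submatrix (Subtype.val : s → ι) Subtype.val)
    simp_rw [this]
    rw [Finset.sum_const, nsmul_eq_mul, Finset.card_univ,
      Fintype.card_equiv (Fintype.equivOfCardEq (by simp [hcard]))]
    simp
  rw [← h1]
  symm
  refine Finset.sum_bij (fun e _ => fun p => (e p : ι)) ?_ ?_ ?_ ?_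
  · intro e _
    have him : Finset.univ.image (fun p => (e p : ι)) = s := by
      ext i
      simp only [Finset.mem_image, Finset.mem_univ, true_and]
      exact ⟨fun ⟨p, hp⟩ => hp ▸ (e p).2, fun hi => ⟨e.symm ⟨i, hi⟩, by simp⟩⟩
    simp only [Finset.mem_filter, Finset.mem_univ, him, hs, and_self]
  · intro e _ e' _ h
    ext p
    exact congrFun h p
  · intro x hx
    simp only [Finset.mem_filter, Finset.mem_univ, true_and] at hx
    have hmem : ∀ p, x p ∈ s := fun p => hx.2 ▸ Finset.mem_image_of_mem x (Finset.mem_univ p)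
    have hsurj : Function.Surjective (fun p => (⟨x p, hmem p⟩ : s)) := by
      rintro ⟨i, hi⟩
      rw [← hx.2] at hi
      obtain ⟨p, -, hp⟩ := Finset.mem_image.1 hi
      exact ⟨p, Subtype.ext hp⟩
    have hbij := (Fintype.bijective_iff_surjective_and_card _).2
      ⟨hsurj, by simp [hcard]⟩
    exact ⟨Equiv.ofBijective _ hbij, Finset.mem_univ _, rfl⟩
  · intro e _
    rfl

/-- The finite Fredholm expansion of `det (1 + M)`. -/
theorem hasSum_det_one_add {ι : Type*} [Fintype ι] [DecidableEq ι] (M : Matrix ι ι ℝ) :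
    HasSum (fun m : ℕ => 1 / (m.factorial : ℝ) * ∑ x : Fin m → ι, (M.submatrix x x).det)
      (1 + M).det := by
  have h : ∀ m : ℕ, 1 / (m.factorial : ℝ) * ∑ x : Fin m → ι, (M.submatrix x x).det =
      ∑ s ∈ Finset.univ.powersetCard m,
        (M.submatrix (Subtype.val : s → ι) Subtype.val).det := fun m => by
    rw [sum_det_submatrix_eq]
    have : (m.factorial : ℝ) ≠ 0 := by positivity
    field_simp
  simp_rw [h]
  have h2 : (1 + M).det = ∑ m ∈ Finset.range (Fintype.card ι + 1),
      ∑ s ∈ Finset.univ.powersetCard m,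
        (M.submatrix (Subtype.val : s → ι) Subtype.val).det := by
    rw [det_one_add_eq_sum_minors, ← Finset.powerset_univ, Finset.sum_powerset]
    rfl
  rw [h2]
  refine hasSum_sum_of_ne_finset_zero fun m hm => ?_
  rw [Finset.powersetCard_eq_empty.2, Finset.sum_empty]
  simpa using hm

theorem trace_sq_eq_sum_eigenvalues_sq {ι : Type*} [Fintype ι] [DecidableEq ι]
    {A : Matrix ι ι ℝ} (hA : A.IsHermitian) : (A * A).trace = ∑ i, hA.eigenvalues i ^ 2 := by
  conv_lhs => rw [hA.spectral_theorem, ← map_mul, Unitary.conjStarAlgAut_apply,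
    Matrix.trace_mul_comm, ← mul_assoc]
  simp [Matrix.diagonal_mul_diagonal, Matrix.trace_diagonal, sq]

/-- For an eigenvalue `x ≥ c`, `log x ≥ 1 - x⁻¹ = (x - 1) - x⁻¹ (x - 1)² ≥ (x - 1) - c⁻¹ (x - 1)²`;
sum over the spectrum. Unlike `c ^ card ι`, this bound need not degenerate as the dimension grows.
-/
theorem exp_le_det_of_coercive {ι : Type*} [Fintype ι] [DecidableEq ι] {A : Matrix ι ι ℝ}
    (hA : A.IsHermitian) {c : ℝ} (hc : 0 < c)
    (hcoer : ∀ v : ι → ℝ, c * (v ⬝ᵥ v) ≤ v ⬝ᵥ A.mulVec v) :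
    Real.exp ((A - 1).trace - c⁻¹ * ((A - 1) * (A - 1)).trace) ≤ A.det := by
  have hev : ∀ i, c ≤ hA.eigenvalues i := fun i => by
    have h := hcoer (hA.eigenvectorBasis i)
    rw [hA.mulVec_eigenvectorBasis, dotProduct_smul, smul_eq_mul] at h
    have h1 : (hA.eigenvectorBasis i : ι → ℝ) ⬝ᵥ (hA.eigenvectorBasis i : ι → ℝ) = 1 := by
      have := hA.eigenvectorBasis.orthonormal.1 i
      have h2 := real_inner_self_eq_norm_sq (hA.eigenvectorBasis i)
      rw [this, EuclideanSpace.inner_eq_star_dotProduct] at h2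
      simpa only [star_trivial, one_pow] using h2
    simpa [h1] using h
  have htr : (A - 1).trace = ∑ i, (hA.eigenvalues i - 1) := by
    rw [Matrix.trace_sub, hA.trace_eq_sum_eigenvalues]
    simp
  have htr2 : ((A - 1) * (A - 1)).trace = ∑ i, (hA.eigenvalues i - 1) ^ 2 := by
    have : (A - 1) * (A - 1) = A * A - (2 : ℝ) • A + 1 := by
      rw [two_smul]; noncomm_ring
    rw [this, Matrix.trace_add, Matrix.trace_sub, trace_sq_eq_sum_eigenvalues_sq hA,
      Matrix.trace_smul, hA.trace_eq_sum_eigenvalues]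
    simp only [sub_sq, Finset.sum_add_distrib, Finset.sum_sub_distrib]
    simp [Finset.mul_sum]
  rw [hA.det_eq_prod_eigenvalues, htr, htr2, Finset.mul_sum, ← Finset.sum_sub_distrib,
    Real.exp_sum]
  refine Finset.prod_le_prod (fun i _ => (Real.exp_pos _).le) fun i _ => ?_
  set x := hA.eigenvalues i
  have hx : 0 < x := hc.trans_le (hev i)
  change _ ≤ x
  rw [← Real.le_log_iff_exp_le hx]
  have h1 := Real.one_sub_inv_le_log_of_pos hx
  have h2 : 1 - x⁻¹ = (x - 1) - x⁻¹ * (x - 1) ^ 2 := by field_simp; ring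
  have h3 : x⁻¹ * (x - 1) ^ 2 ≤ c⁻¹ * (x - 1) ^ 2 := by
    have := hev i
    gcongr
  linarith

end LinearAlgebra

end FunctionalLikelihood

noncomputable section

namespace FunctionalLikelihood

/-! ### Grid cells, step functions and Riemann sums. -/

section Grid

/-- The index of the grid cell of width `1/n` containing `t` (endpoints are assigned to the cell on
their right, and `1` to the last cell). -/
def cellIdx (n : ℕ) [NeZero n] (t : I) : Fin n :=
  ⟨min ⌊(n : ℝ) * t⌋₊ (n - 1), by have := NeZero.pos n; omega⟩

/-- The midpoint of the grid cell containing `t`. -/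
def gridRound (n : ℕ) [NeZero n] (t : I) : I := midpt n (cellIdx n t)

section Cells

variable {n : ℕ} [NeZero n]

theorem measurable_cellIdx : Measurable (cellIdx n) := by
  refine measurable_to_countable' fun i => ?_
  have : cellIdx n ⁻¹' {i} = (fun t : I => min ⌊(n : ℝ) * t⌋₊ (n - 1)) ⁻¹' {(i : ℕ)} := by
    ext t; simp [cellIdx, Fin.ext_iff]
  rw [this]
  refine measurableSet_preimage ?_ (measurableSet_singleton _)
  exact (Nat.measurable_floor.comp (measurable_subtype_coe.const_mul _)).min measurable_const

theorem dist_gridRound_le (t : I) : dist (gridRound n t) t ≤ 1 / n := by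
  have hn : (0 : ℝ) < n := by exact_mod_cast NeZero.pos n
  have h0 : (0 : ℝ) ≤ n * t := mul_nonneg hn.le t.2.1
  have h1 : (n : ℝ) * t ≤ n := mul_le_of_le_one_right hn.le t.2.2
  have h2 := Nat.floor_le h0
  have h3 := Nat.lt_floor_add_one ((n : ℝ) * t)
  have hcast : ((n - 1 : ℕ) : ℝ) = n - 1 := by
    rw [Nat.cast_sub (NeZero.one_le), Nat.cast_one]
  have hidx : |((cellIdx n t : ℕ) : ℝ) + 1 / 2 - n * t| ≤ 1 := by
    simp only [cellIdx]
    rcases le_total ⌊(n : ℝ) * t⌋₊ (n - 1) with h | h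
    · rw [min_eq_left h, abs_le]
      constructor <;> linarith
    · rw [min_eq_right h, abs_le, hcast]
      have : ((n - 1 : ℕ) : ℝ) ≤ ⌊(n : ℝ) * t⌋₊ := by exact_mod_cast h
      rw [hcast] at this
      constructor <;> linarith
  rw [Subtype.dist_eq, Real.dist_eq]
  have : ((gridRound n t : I) : ℝ) - t = (((cellIdx n t : ℕ) : ℝ) + 1 / 2 - n * t) / n := by
    change (((cellIdx n t : ℕ) : ℝ) + 1 / 2) / n - t = _
    field_simp
  rw [this, abs_div, abs_of_pos hn]
  gcongr

theorem cellIdx_eq_of_mem_cell {i : Fin n} {t : I} (ht : t ∈ cell n i) : cellIdx n t = i := by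
  have hn : (0 : ℝ) < n := by exact_mod_cast NeZero.pos n
  obtain ⟨h1, h2⟩ := ht
  rw [div_lt_iff₀ hn] at h1
  rw [lt_div_iff₀ hn] at h2
  have h3 : ⌊(n : ℝ) * t⌋₊ = (i : ℕ) := by
    rw [Nat.floor_eq_iff (mul_nonneg hn.le t.2.1)]
    constructor <;> linarith
  refine Fin.ext ?_
  simp only [cellIdx, h3]
  have := i.2
  omega

/-- The only exceptions are among the countably many `t` with `n t` a natural number. -/
theorem ae_mem_cell_cellIdx : ∀ᵐ t : I, t ∈ cell n (cellIdx n t) := by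
  have hn : (0 : ℝ) < n := by exact_mod_cast NeZero.pos n
  have hc : ((fun t : I => (n : ℝ) * t) ⁻¹' Set.range ((↑) : ℕ → ℝ)).Countable := by
    refine (Set.countable_range _).preimage_of_injOn ?_
    intro s _ t _ h
    exact Subtype.ext (mul_left_cancel₀ hn.ne' h)
  filter_upwards [hc.ae_notMem volume] with t ht
  have h0 : (0 : ℝ) ≤ n * t := mul_nonneg hn.le t.2.1
  have h2 : (⌊(n : ℝ) * t⌋₊ : ℝ) < n * t :=
    lt_of_le_of_ne (Nat.floor_le h0) fun h => ht ⟨_, h⟩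
  have h3 := Nat.lt_floor_add_one ((n : ℝ) * t)
  have h1 : (n : ℝ) * t < n :=
    lt_of_le_of_ne (mul_le_of_le_one_right hn.le t.2.2) fun h => ht ⟨n, h.symm⟩
  have h4 : ⌊(n : ℝ) * t⌋₊ < n := by exact_mod_cast h2.trans h1
  have h5 : (cellIdx n t : ℕ) = ⌊(n : ℝ) * t⌋₊ := by
    simp only [cellIdx]; omega
  rw [cell, Set.mem_ofPred_eq, h5, div_lt_iff₀ hn, lt_div_iff₀ hn]
  constructor <;> linarith

theorem volume_cell (i : Fin n) : volume (cell n i) = ENNReal.ofReal (1 / n) := by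
  have hn : (0 : ℝ) < n := by exact_mod_cast NeZero.pos n
  have hi : ((i : ℕ) : ℝ) + 1 ≤ n := by exact_mod_cast i.2
  have himg : Subtype.val '' cell n i = Set.Ioo ((i : ℝ) / n) (((i : ℝ) + 1) / n) := by
    ext x
    constructor
    · rintro ⟨t, ht, rfl⟩
      exact ht
    · intro hx
      refine ⟨⟨x, ?_, ?_⟩, hx, rfl⟩
      · exact (lt_of_le_of_lt (by positivity) hx.1).le
      · exact hx.2.le.trans ((div_le_one hn).2 hi)
  rw [unitInterval.volume_apply, himg, Real.volume_Ioo]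
  congr 1
  field_simp
  ring

theorem volume_preimage_cellIdx (i : Fin n) :
    volume (cellIdx n ⁻¹' {i}) = ENNReal.ofReal (1 / n) := by
  rw [← volume_cell i]
  refine measure_congr ?_
  filter_upwards [ae_mem_cell_cellIdx (n := n)] with t ht
  refine propext ⟨fun h => ?_, fun h => cellIdx_eq_of_mem_cell h⟩
  have h' : cellIdx n t = i := h
  exact h' ▸ ht

/-- Integrals over `[0,1]^m` of functions of the grid cells are normalised finite sums. -/
theorem integral_pi_comp_cellIdx (m : ℕ) (g : (Fin m → Fin n) → ℝ) :
    ∫ x : Fin m → I, g (fun p => cellIdx n (x p)) = (1 / (n : ℝ)) ^ m * ∑ x, g x := by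
  have hmeas : Measurable fun (x : Fin m → I) p => cellIdx n (x p) :=
    measurable_pi_lambda _ fun p => measurable_cellIdx.comp (measurable_pi_apply p)
  rw [← integral_map (φ := fun (x : Fin m → I) p => cellIdx n (x p)) hmeas.aemeasurable
    (measurable_of_countable g).aestronglyMeasurable,
    integral_fintype (Integrable.of_finite), Finset.mul_sum]
  refine Finset.sum_congr rfl fun x _ => ?_
  rw [smul_eq_mul, measureReal_def, Measure.map_apply hmeas (measurableSet_singleton _)]
  have : (fun (x : Fin m → I) p => cellIdx n (x p)) ⁻¹' {x} =
      Set.univ.pi fun p => cellIdx n ⁻¹' {x p} := by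
    ext z; simp [funext_iff]
  rw [this, volume_pi_pi]
  simp only [volume_preimage_cellIdx, Finset.prod_const, Finset.card_univ, Fintype.card_fin]
  rw [ENNReal.toReal_pow, ENNReal.toReal_ofReal (by positivity)]

theorem integral_comp_cellIdx (g : Fin n → ℝ) :
    ∫ t : I, g (cellIdx n t) = 1 / (n : ℝ) * ∑ i, g i := by
  rw [← integral_map (φ := cellIdx n) measurable_cellIdx.aemeasurable
    (measurable_of_countable g).aestronglyMeasurable,
    integral_fintype (Integrable.of_finite), Finset.mul_sum]
  refine Finset.sum_congr rfl fun i _ => ?_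
  rw [smul_eq_mul, measureReal_def,
    Measure.map_apply measurable_cellIdx (measurableSet_singleton _), volume_preimage_cellIdx,
    ENNReal.toReal_ofReal (by positivity)]

theorem embed_ae (y : Fin n → ℝ) : embed y =ᵐ[volume] fun t => y (cellIdx n t) := by
  have h1 : embed y =ᵐ[volume] fun t => ∑ i, (cell n i).indicator (fun _ => y i) t := by
    have hall : ∀ᵐ t : I, ∀ i : Fin n,
        (indicatorConstLp 2 (measurableSet_cell n i) (measure_ne_top volume _) (y i) : L2) t =
          (cell n i).indicator (fun _ => y i) t :=
      ae_all_iff.2 fun i => indicatorConstLp_coeFn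
    have hs := Lp.coeFn_finsetSum Finset.univ fun i : Fin n =>
        (indicatorConstLp 2 (measurableSet_cell n i) (measure_ne_top volume _) (y i) : L2)
    filter_upwards [hall, hs] with t ht hs
    rw [embed, hs, Finset.sum_apply]
    exact Finset.sum_congr rfl fun i _ => ht i
  filter_upwards [h1, ae_mem_cell_cellIdx (n := n)] with t ht hcell
  rw [ht, Finset.sum_eq_single (cellIdx n t)]
  · rw [Set.indicator_of_mem hcell]
  · intro i _ hi
    exact Set.indicator_of_notMem (fun h => hi (cellIdx_eq_of_mem_cell h).symm) _
  · simp

/-- This scaling transfers coercivity and quadratic forms between `L²` and `ℝⁿ`. -/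
theorem inner_embed (y z : Fin n → ℝ) :
    inner ℝ (embed y) (embed z) = 1 / (n : ℝ) * (y ⬝ᵥ z) := by
  rw [L2.inner_def, dotProduct, ← integral_comp_cellIdx]
  refine integral_congr_ae ?_
  filter_upwards [embed_ae y, embed_ae z] with t hy hz
  rw [hy, hz]
  simp [mul_comm]

end Cells

theorem tendsto_gridRound_succ (t : I) :
    Tendsto (fun n : ℕ => gridRound (n + 1) t) atTop (𝓝 t) := by
  rw [tendsto_iff_dist_tendsto_zero]
  refine squeeze_zero (fun _ => dist_nonneg) (fun n => dist_gridRound_le t) ?_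
  exact_mod_cast tendsto_one_div_add_atTop_nhds_zero_nat (𝕜 := ℝ)

/-- Convergence of midpoint Riemann sums on `[0,1]^m`. -/
theorem tendsto_riemannSum_pi {m : ℕ} {F : (Fin m → I) → ℝ} (hF : Continuous F) :
    Tendsto (fun n : ℕ => (1 / (n : ℝ)) ^ m * ∑ x : Fin m → Fin n, F fun p => midpt n (x p)) atTop
      (𝓝 (∫ x, F x)) := by
  -- Shifting to `n + 1` supplies the `NeZero` instance that `cellIdx` requires.
  rw [← tendsto_add_atTop_iff_nat 1]
  simp_rw [← integral_pi_comp_cellIdx m (fun x => F fun p => midpt _ (x p))]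
  let G : C(Fin m → I, ℝ) := ⟨F, hF⟩
  refine tendsto_integral_of_dominated_convergence (fun _ => ‖G‖) (fun n => ?_)
    (integrable_const _) (fun n => Eventually.of_forall fun x => G.norm_coe_le_norm _)
    (Eventually.of_forall fun x => ?_)
  · have hmeas : Measurable fun (x : Fin m → I) p => cellIdx (n + 1) (x p) :=
      measurable_pi_lambda _ fun p => measurable_cellIdx.comp (measurable_pi_apply p)
    exact ((measurable_of_countable
      fun x : Fin m → Fin (n + 1) => F fun p => midpt _ (x p)).comp hmeas).aestronglyMeasurable
  · exact (hF.tendsto x).comp (tendsto_pi_nhds.2 fun p => tendsto_gridRound_succ (x p))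

theorem tendsto_riemannSum {F : I → ℝ} (hF : Continuous F) :
    Tendsto (fun n : ℕ => 1 / (n : ℝ) * ∑ i : Fin n, F (midpt n i)) atTop (𝓝 (∫ t, F t)) := by
  rw [← tendsto_add_atTop_iff_nat 1]
  simp_rw [← integral_comp_cellIdx (fun i => F (midpt _ i))]
  let G : C(I, ℝ) := ⟨F, hF⟩
  refine tendsto_integral_of_dominated_convergence (fun _ => ‖G‖) (fun n => ?_)
    (integrable_const _) (fun n => Eventually.of_forall fun x => G.norm_coe_le_norm _)
    (Eventually.of_forall fun t => ?_)
  · exact ((measurable_of_countable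
      fun i : Fin (n + 1) => F (midpt _ i)).comp measurable_cellIdx).aestronglyMeasurable
  · exact (hF.tendsto t).comp (tendsto_gridRound_succ t)

end Grid

end FunctionalLikelihood

end

noncomputable section

namespace FunctionalLikelihood

/-! ### Integral operators: Nyström error, compactness, symmetry. -/

section Operators

theorem norm_le_of_ae_abs_le {f : L2} {C : ℝ} (hC : 0 ≤ C) (h : ∀ᵐ t, |f t| ≤ C) : ‖f‖ ≤ C := by
  have h1 := Lp.norm_le_of_ae_bound (f := f) hC h
  have h2 : measureUnivNNReal (volume : Measure I) = 1 := by simp [measureUnivNNReal]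
  simpa [h2] using h1

theorem integral_abs_le_norm (f : L2) : ∫ s, |f s| ≤ ‖f‖ := by
  have h := eLpNorm_le_eLpNorm_of_exponent_le (p := 1) (q := 2) (μ := (volume : Measure I))
    (by norm_num) (Lp.aestronglyMeasurable f)
  simp_rw [← Real.norm_eq_abs]
  rw [Lp.norm_def, integral_norm_eq_lintegral_enorm (Lp.aestronglyMeasurable f),
    ← eLpNorm_one_eq_lintegral_enorm]
  exact ENNReal.toReal_mono (Lp.eLpNorm_ne_top f) h

theorem abs_integral_mul_le {g : I → ℝ} {ε : ℝ} (hg : ∀ s, |g s| ≤ ε) (f : L2) :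
    |∫ s, g s * f s| ≤ ε * ‖f‖ := by
  have hε : 0 ≤ ε := (abs_nonneg _).trans (hg 0)
  calc |∫ s, g s * f s| ≤ ∫ s, ε * |f s| := by
        refine norm_integral_le_of_norm_le (f := fun s => g s * f s)
          ((integrable_coe f).abs.const_mul _) ?_
        filter_upwards with s
        rw [Real.norm_eq_abs, abs_mul]
        exact mul_le_mul_of_nonneg_right (hg s) (abs_nonneg _)
    _ = ε * ∫ s, |f s| := integral_const_mul _ _
    _ ≤ ε * ‖f‖ := by gcongr; exact integral_abs_le_norm f

theorem norm_embed_le {n : ℕ} {y : Fin n → ℝ} {C : ℝ} (hC : 0 ≤ C) (hy : ∀ i, |y i| ≤ C) :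
    ‖embed y‖ ≤ C := by
  rcases Nat.eq_zero_or_pos n with rfl | hn
  · simpa [embed] using hC
  have : NeZero n := ⟨hn.ne'⟩
  refine norm_le_of_ae_abs_le hC ?_
  filter_upwards [embed_ae y] with t ht
  rw [ht]
  exact hy _

theorem exists_forall_dist_le {X : Type*} [PseudoMetricSpace X] [CompactSpace X] (F : C(X, ℝ))
    {ε : ℝ} (hε : 0 < ε) :
    ∃ N : ℕ, ∀ n ≥ N, ∀ a b : X, dist a b ≤ 1 / n → |F a - F b| ≤ ε := by
  obtain ⟨δ, hδ, h⟩ := Metric.uniformContinuous_iff.1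
    (CompactSpace.uniformContinuous_of_continuous F.continuous) ε hε
  obtain ⟨N, hN⟩ := exists_nat_one_div_lt hδ
  refine ⟨N + 1, fun n hn a b hab => (h (lt_of_le_of_lt (hab.trans ?_) hN)).le⟩
  have : (N : ℝ) + 1 ≤ n := by exact_mod_cast hn
  gcongr

theorem measurable_gridRound {n : ℕ} [NeZero n] : Measurable (gridRound n) :=
  (measurable_of_countable (midpt n)).comp measurable_cellIdx

/-- The Nyström discretisation of `1 + K` on piecewise constant functions. -/
theorem norm_one_add_intOp_embed_sub_le {n : ℕ} [NeZero n] (k : C(I × I, ℝ)) {ε : ℝ}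
    (hε : ∀ t s, |k (t, s) - k (gridRound n t, gridRound n s)| ≤ ε) (u : Fin n → ℝ) :
    ‖(1 + intOp k) (embed u) - embed ((matR k n).mulVec u)‖ ≤ ε * ‖embed u‖ := by
  have hε0 : 0 ≤ ε := (abs_nonneg _).trans (hε 0 0)
  refine norm_le_of_ae_abs_le (by positivity) ?_
  have h1 := Lp.coeFn_sub ((1 + intOp k) (embed u)) (embed ((matR k n).mulVec u))
  have h2 := Lp.coeFn_add (embed u) (intOp k (embed u))
  filter_upwards [h1, h2, intOp_ae k (embed u), embed_ae u, embed_ae ((matR k n).mulVec u)]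
    with t h1 h2 h3 h4 h5
  -- On step functions `R_n` is exactly the identity plus the integral operator whose kernel is
  -- rounded in both variables, so only the kernel error survives.
  have hmv : (matR k n).mulVec u (cellIdx n t) = u (cellIdx n t) +
      ∫ s, k (gridRound n t, gridRound n s) * embed u s := by
    have : ∫ s, k (gridRound n t, gridRound n s) * embed u s =
        ∫ s, (fun j => k (midpt n (cellIdx n t), midpt n j) * u j) (cellIdx n s) := by
      refine integral_congr_ae ?_
      filter_upwards [embed_ae u] with s hs
      rw [hs]
      rfl
    rw [this, integral_comp_cellIdx (n := n) fun j => k (midpt n (cellIdx n t), midpt n j) * u j,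
      Matrix.mulVec, dotProduct, Finset.mul_sum]
    simp only [matR, Matrix.of_apply, add_mul, Finset.sum_add_distrib, ite_mul, one_mul, zero_mul,
      Finset.sum_ite_eq, Finset.mem_univ, if_true, mul_assoc]
    rw [add_comm]
  have h6 : Integrable (fun s => k (gridRound n t, gridRound n s) * embed u s) volume := by
    refine (integrable_coe (embed u)).bdd_mul (c := ‖k‖) ?_ ?_
    · exact (k.continuous.measurable.comp
        (measurable_const.prodMk measurable_gridRound)).aestronglyMeasurable
    · exact Eventually.of_forall fun s => k.norm_coe_le_norm _
  have h7 : ((1 + intOp k) (embed u) - embed ((matR k n).mulVec u) : L2) t =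
      ∫ s, (k (t, s) - k (gridRound n t, gridRound n s)) * embed u s := by
    rw [h1, Pi.sub_apply, h5, hmv]
    have : ((1 + intOp k) (embed u) : L2) = embed u + intOp k (embed u) := rfl
    rw [this, h2, Pi.add_apply, h3, h4]
    simp_rw [sub_mul]
    rw [integral_sub (integrable_kernel_mul k _ t) h6]
    ring
  rw [h7]
  exact abs_integral_mul_le (hε t) _

theorem eventually_norm_one_add_intOp_embed_sub_le (k : C(I × I, ℝ)) {ε : ℝ} (hε : 0 < ε) :
    ∀ᶠ n : ℕ in atTop, ∀ u : Fin n → ℝ,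
      ‖(1 + intOp k) (embed u) - embed ((matR k n).mulVec u)‖ ≤ ε * ‖embed u‖ := by
  obtain ⟨N, hN⟩ := exists_forall_dist_le k hε
  filter_upwards [eventually_ge_atTop N, eventually_gt_atTop 0] with n hn hpos u
  have : NeZero n := ⟨hpos.ne'⟩
  refine norm_one_add_intOp_embed_sub_le k (fun t s => hN n hn _ _ ?_) u
  rw [dist_comm, Prod.dist_eq]
  exact max_le (dist_gridRound_le t) (dist_gridRound_le s)

/-- The degenerate kernel operator obtained by rounding the second variable of `k` to the grid. -/
def finiteRankOp (k : C(I × I, ℝ)) (n : ℕ) : L2 →L[ℝ] L2 :=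
  ∑ j : Fin n, (innerSL ℝ (embed (Pi.single j 1 : Fin n → ℝ))).smulRight
    (ContinuousMap.toLp 2 volume ℝ (k.comp ⟨fun t => (t, midpt n j), by fun_prop⟩))

theorem isCompactOperator_finiteRankOp (k : C(I × I, ℝ)) (n : ℕ) :
    IsCompactOperator (finiteRankOp k n) := by
  have h : finiteRankOp k n ∈ compactOperator (RingHom.id ℝ) L2 L2 := by
    refine Submodule.sum_mem _ fun j _ => ?_
    exact (isCompactOperator_of_locallyCompactSpace_rng
      (ContinuousLinearMap.toSpanSingleton ℝ (ContinuousMap.toLp 2 volume ℝ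
        (k.comp ⟨fun t => (t, midpt n j), by fun_prop⟩)))).comp_clm
      (innerSL ℝ (embed (Pi.single j 1 : Fin n → ℝ)))
  exact h

theorem finiteRankOp_ae {n : ℕ} [NeZero n] (k : C(I × I, ℝ)) (f : L2) :
    finiteRankOp k n f =ᵐ[volume] fun t => ∫ s, k (t, gridRound n s) * f s := by
  have hall : ∀ᵐ t : I, ∀ j : Fin n,
      (inner ℝ (embed (Pi.single j 1 : Fin n → ℝ)) f •
        ContinuousMap.toLp 2 volume ℝ (k.comp ⟨fun t => (t, midpt n j), by fun_prop⟩) : L2) t =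
        inner ℝ (embed (Pi.single j 1 : Fin n → ℝ)) f * k (t, midpt n j) := by
    refine ae_all_iff.2 fun j => ?_
    filter_upwards [Lp.coeFn_smul (inner ℝ (embed (Pi.single j 1 : Fin n → ℝ)) f)
      (ContinuousMap.toLp 2 volume ℝ (k.comp ⟨fun t => (t, midpt n j), by fun_prop⟩) : L2),
      ContinuousMap.coeFn_toLp (p := 2) (𝕜 := ℝ) (volume : Measure I)
        (k.comp ⟨fun t => (t, midpt n j), by fun_prop⟩)] with t h1 h2
    rw [h1, Pi.smul_apply, h2]
    rfl
  have hs := Lp.coeFn_finsetSum Finset.univ fun j : Fin n =>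
    (inner ℝ (embed (Pi.single j 1 : Fin n → ℝ)) f •
      ContinuousMap.toLp 2 volume ℝ (k.comp ⟨fun t => (t, midpt n j), by fun_prop⟩) : L2)
  filter_upwards [hall, hs] with t ht hs
  have h0 : finiteRankOp k n f = ∑ j : Fin n, (inner ℝ (embed (Pi.single j 1 : Fin n → ℝ)) f •
      ContinuousMap.toLp 2 volume ℝ (k.comp ⟨fun t => (t, midpt n j), by fun_prop⟩) : L2) := by
    simp [finiteRankOp]
  rw [h0, hs, Finset.sum_apply]
  simp_rw [ht]
  have hin : ∀ j : Fin n, inner ℝ (embed (Pi.single j 1 : Fin n → ℝ)) f * k (t, midpt n j) =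
      ∫ s, (if cellIdx n s = j then k (t, midpt n j) else 0) * f s := by
    intro j
    rw [L2.inner_def, ← integral_mul_const]
    refine integral_congr_ae ?_
    filter_upwards [embed_ae (Pi.single j 1 : Fin n → ℝ)] with s hs
    rw [hs, Pi.single_apply]
    split_ifs <;> simp [mul_comm]
  simp_rw [hin]
  rw [← integral_finsetSum]
  · refine integral_congr_ae (Eventually.of_forall fun s => ?_)
    simp [gridRound]
  · intro j _
    refine (integrable_coe f).bdd_mul (c := ‖k‖) ?_ ?_
    · exact ((measurable_of_countable fun i : Fin n => if i = j then k (t, midpt n j) else 0).comp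
        measurable_cellIdx).aestronglyMeasurable
    · refine Eventually.of_forall fun s => ?_
      split_ifs
      · exact k.norm_coe_le_norm _
      · simp

/-- Rounding one variable changes `k` by a uniformly small amount, and a uniform kernel bound
controls the operator norm because the measure has total mass one. -/
theorem tendsto_finiteRankOp (k : C(I × I, ℝ)) :
    Tendsto (finiteRankOp k) atTop (𝓝 (intOp k)) := by
  rw [Metric.tendsto_atTop']
  intro ε hε
  obtain ⟨N, hN⟩ := exists_forall_dist_le k (half_pos hε)
  refine ⟨N, fun n hn => lt_of_le_of_lt ?_ (half_lt_self hε)⟩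
  have : NeZero n := ⟨by omega⟩
  rw [dist_comm, dist_eq_norm]
  refine ContinuousLinearMap.opNorm_le_bound _ (by positivity) fun f => ?_
  refine norm_le_of_ae_abs_le (by positivity) ?_
  filter_upwards [Lp.coeFn_sub (intOp k f) (finiteRankOp k n f), intOp_ae k f,
    finiteRankOp_ae (n := n) k f] with t h1 h2 h3
  have h4 : ((intOp k - finiteRankOp k n) f : L2) t =
      ∫ s, (k (t, s) - k (t, gridRound n s)) * f s := by
    change ((intOp k f - finiteRankOp k n f : L2) : I → ℝ) t = _
    rw [h1, Pi.sub_apply, h2, h3]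
    simp_rw [sub_mul]
    refine (integral_sub (integrable_kernel_mul k _ t) ?_).symm
    refine (integrable_coe f).bdd_mul (c := ‖k‖) ?_ ?_
    · exact (k.continuous.measurable.comp
        (measurable_const.prodMk measurable_gridRound)).aestronglyMeasurable
    · exact Eventually.of_forall fun s => k.norm_coe_le_norm _
  rw [h4]
  refine abs_integral_mul_le (fun s => hN n hn.le _ _ ?_) f
  rw [dist_comm, Prod.dist_eq, dist_self]
  exact max_le (by positivity) (dist_gridRound_le s)

theorem isCompactOperator_intOp (k : C(I × I, ℝ)) : IsCompactOperator (intOp k) :=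
  isCompactOperator_of_tendsto (tendsto_finiteRankOp k)
    (Eventually.of_forall (isCompactOperator_finiteRankOp k))

theorem inner_intOp_symm {k : C(I × I, ℝ)} (hsymm : ∀ s t, k (s, t) = k (t, s)) (f g : L2) :
    inner ℝ (intOp k f) g = inner ℝ f (intOp k g) := by
  have hl : inner ℝ (intOp k f) g = ∫ t, ∫ s, g t * (k (t, s) * f s) := by
    rw [L2.inner_def]
    refine integral_congr_ae ?_
    filter_upwards [intOp_ae k f] with t ht
    rw [integral_const_mul, ht]
    rfl
  have hr : inner ℝ f (intOp k g) = ∫ s, ∫ t, g t * (k (t, s) * f s) := by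
    rw [L2.inner_def]
    refine integral_congr_ae ?_
    filter_upwards [intOp_ae k g] with s hs
    rw [hs]
    change (∫ t, k (s, t) * g t) * f s = _
    rw [← integral_mul_const]
    refine integral_congr_ae (Eventually.of_forall fun t => ?_)
    simp only [hsymm s t]
    ring
  rw [hl, hr]
  refine integral_integral_swap ?_
  have h := ((integrable_coe g).mul_prod (integrable_coe f)).bdd_mul (c := ‖k‖)
    (f := fun z : I × I => k z) k.continuous.aestronglyMeasurable
    (Eventually.of_forall fun z => k.norm_coe_le_norm _)
  refine h.congr (Eventually.of_forall fun z => ?_)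
  simp only [Function.uncurry]
  ring

/-! ### Multiplication operators. -/

theorem mulOp_mul (D E : C(I, ℝ)) : mulOp D * mulOp E = mulOp (D * E) := by
  ext f
  change (mulOp D (mulOp E f) : I → ℝ) =ᵐ[volume] _
  filter_upwards [mulOp_ae D (mulOp E f), mulOp_ae E f, mulOp_ae (D * E) f] with t h1 h2 h3
  rw [h1, h2, h3, ContinuousMap.mul_apply, mul_assoc]

theorem mulOp_one : mulOp 1 = 1 := by
  ext f
  change _ =ᵐ[volume] (f : I → ℝ)
  filter_upwards [mulOp_ae 1 f] with t h1
  rw [h1, ContinuousMap.one_apply, one_mul]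

theorem inner_mulOp (D : C(I, ℝ)) (f g : L2) :
    inner ℝ (mulOp D f) g = inner ℝ f (mulOp D g) := by
  rw [L2.inner_def, L2.inner_def]
  refine integral_congr_ae ?_
  filter_upwards [mulOp_ae D f, mulOp_ae D g] with t h1 h2
  rw [h1, h2]
  simp only [RCLike.inner_apply, conj_trivial]
  ring

/-- The pointwise inverse of a positive continuous function. -/
def invFun (D : C(I, ℝ)) (hD : ∀ t, 0 < D t) : C(I, ℝ) :=
  ⟨fun t => (D t)⁻¹, D.continuous.inv₀ fun t => (hD t).ne'⟩

theorem mulOp_mul_invFun (D : C(I, ℝ)) (hD : ∀ t, 0 < D t) :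
    mulOp D * mulOp (invFun D hD) = 1 := by
  rw [mulOp_mul, ← mulOp_one]
  congr 1
  ext t
  exact mul_inv_cancel₀ (hD t).ne'

theorem mulOp_invFun_mul (D : C(I, ℝ)) (hD : ∀ t, 0 < D t) :
    mulOp (invFun D hD) * mulOp D = 1 := by
  rw [mulOp_mul, mul_comm, ← mulOp_mul, mulOp_mul_invFun]

/-- Multiplication by a positive continuous function as a unit of the operator algebra. -/
def mulOpUnit (D : C(I, ℝ)) (hD : ∀ t, 0 < D t) : (L2 →L[ℝ] L2)ˣ :=
  ⟨mulOp D, mulOp (invFun D hD), mulOp_mul_invFun D hD, mulOp_invFun_mul D hD⟩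

/-! ### Coercivity and the Fredholm alternative. -/

/-- A bounded symmetric positive invertible operator is coercive. -/
theorem exists_coercive_of_isUnit {E : Type*} [NormedAddCommGroup E] [InnerProductSpace ℝ E]
    {A : E →L[ℝ] E} (hA : IsUnit A) (hs : ∀ f g, inner ℝ (A f) g = inner ℝ f (A g))
    (hp : ∀ f, 0 ≤ inner ℝ f (A f)) :
    ∃ c > 0, ∀ f, c * ‖f‖ ^ 2 ≤ inner ℝ f (A f) := by
  obtain ⟨u, rfl⟩ := hA
  set A : E →L[ℝ] E := u.val
  set B : E →L[ℝ] E := u⁻¹.val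
  have hBA : ∀ f, B (A f) = f := fun f => congrArg (fun T : E →L[ℝ] E => T f) u.inv_mul
  set s : ℝ := (‖A‖ + 1)⁻¹
  have hs0 : 0 < s := by positivity
  have hsA : s * ‖A‖ ≤ 1 := by
    rw [inv_mul_le_iff₀ (by positivity)]; linarith
  refine ⟨s * ((‖B‖ + 1) ^ 2)⁻¹, by positivity, fun f => ?_⟩
  -- Positivity at `f - s A f`, with `s ‖A‖ ≤ 1`, gives `⟨f, A f⟩ ≥ s ‖A f‖²` without using a square
  -- root of `A`; the inverse `B` then bounds `‖A f‖` below.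
  have h1 := hp (f - s • A f)
  have h2 : inner ℝ (f - s • A f) (A (f - s • A f)) =
      inner ℝ f (A f) - 2 * s * ‖A f‖ ^ 2 + s ^ 2 * inner ℝ (A f) (A (A f)) := by
    rw [map_sub, map_smul, inner_sub_left, inner_sub_right, inner_sub_right, inner_smul_left,
      inner_smul_left, inner_smul_right, inner_smul_right, ← hs f (A f),
      real_inner_self_eq_norm_sq]
    simp only [conj_trivial]
    ring
  have h3 : inner ℝ (A f) (A (A f)) ≤ ‖A‖ * ‖A f‖ ^ 2 := by
    calc inner ℝ (A f) (A (A f)) ≤ ‖A f‖ * ‖A (A f)‖ := real_inner_le_norm _ _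
      _ ≤ ‖A f‖ * (‖A‖ * ‖A f‖) := by gcongr; exact A.le_opNorm _
      _ = _ := by ring
  have h4 : s ^ 2 * inner ℝ (A f) (A (A f)) ≤ s * ‖A f‖ ^ 2 := by
    calc s ^ 2 * inner ℝ (A f) (A (A f)) ≤ s ^ 2 * (‖A‖ * ‖A f‖ ^ 2) := by gcongr
      _ = s * (s * ‖A‖) * ‖A f‖ ^ 2 := by ring
      _ ≤ s * 1 * ‖A f‖ ^ 2 := by gcongr
      _ = _ := by ring
  have h5 : ‖f‖ ≤ (‖B‖ + 1) * ‖A f‖ := by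
    calc ‖f‖ = ‖B (A f)‖ := by rw [hBA]
      _ ≤ ‖B‖ * ‖A f‖ := B.le_opNorm _
      _ ≤ _ := by gcongr; linarith
  have h6 : ((‖B‖ + 1) ^ 2)⁻¹ * ‖f‖ ^ 2 ≤ ‖A f‖ ^ 2 := by
    rw [inv_mul_le_iff₀ (by positivity), ← mul_pow]
    gcongr
  rw [mul_assoc]
  have h7 : s * (((‖B‖ + 1) ^ 2)⁻¹ * ‖f‖ ^ 2) ≤ s * ‖A f‖ ^ 2 := by gcongr
  linarith

/-- The Fredholm alternative for `1 + K` under positivity. -/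
theorem isUnit_one_add_intOp {k : C(I × I, ℝ)}
    (hp : ∀ f : L2, f ≠ 0 → 0 < inner ℝ f ((1 + intOp k) f)) : IsUnit (1 + intOp k) := by
  rcases (isCompactOperator_intOp k).hasEigenvalue_or_mem_resolventSet
    (μ := (-1 : ℝ)) (by norm_num) with h | h
  · obtain ⟨f, hf⟩ := h.exists_hasEigenvector
    have h1 : intOp k f = (-1 : ℝ) • f := hf.apply_eq_smul
    have h2 := hp f hf.2
    have h3 : (1 + intOp k) f = 0 := by
      change f + intOp k f = 0
      rw [h1]; simp
    rw [h3, inner_zero_right] at h2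
    exact absurd h2 (lt_irrefl _)
  -- The resolvent set speaks of `-1 - K`, hence the negation.
  · rw [spectrum.mem_resolventSet_iff, ← IsUnit.neg_iff] at h
    convert h using 1
    rw [map_neg, map_one]
    abel

end Operators

end FunctionalLikelihood

end

noncomputable section

namespace FunctionalLikelihood

/-! ### The Fredholm determinant as a limit of matrix determinants. -/

section FredholmDeterminant

theorem abs_kernel_le (k : C(I × I, ℝ)) (z : I × I) : |k z| ≤ ‖k‖ := k.norm_coe_le_norm z

theorem abs_det_kernel_le (k : C(I × I, ℝ)) {m : ℕ} (x : Fin m → I) :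
    |(Matrix.of fun p q : Fin m => k (x p, x q)).det| ≤ (‖k‖ * √m) ^ m :=
  abs_det_le_of_entries _ (norm_nonneg k) fun _ _ => abs_kernel_le k _

theorem continuous_det_kernel (k : C(I × I, ℝ)) (m : ℕ) :
    Continuous fun x : Fin m → I => (Matrix.of fun p q : Fin m => k (x p, x q)).det := by
  refine Continuous.matrix_det (continuous_matrix fun p q => ?_)
  exact k.continuous.comp (by fun_prop)

theorem abs_fredholmTerm_le (k : C(I × I, ℝ)) (m : ℕ) :
    |fredholmTerm k m| ≤ 1 / (m.factorial : ℝ) * (‖k‖ * √m) ^ m := by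
  rw [fredholmTerm, abs_mul, abs_of_nonneg (by positivity : (0 : ℝ) ≤ 1 / (m.factorial : ℝ))]
  gcongr
  have := norm_integral_le_of_norm_le_const (μ := (volume : Measure (Fin m → I)))
    (f := fun x : Fin m → I => (Matrix.of fun p q : Fin m => k (x p, x q)).det)
    (Eventually.of_forall fun x => abs_det_kernel_le k x)
  simpa using this

theorem summable_fredholmTerm (k : C(I × I, ℝ)) : Summable (fredholmTerm k) :=
  Summable.of_norm_bounded (summable_hadamard_bound ‖k‖ (norm_nonneg k)) (abs_fredholmTerm_le k)

theorem matR_eq (k : C(I × I, ℝ)) (n : ℕ) :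
    matR k n = 1 + (1 / (n : ℝ)) • Matrix.of fun i j => k (midpt n i, midpt n j) := by
  ext i j
  simp [matR, Matrix.one_apply, add_comm]

theorem hasSum_det_matR (k : C(I × I, ℝ)) (n : ℕ) :
    HasSum (fun m : ℕ => 1 / (m.factorial : ℝ) * ((1 / (n : ℝ)) ^ m * ∑ x : Fin m → Fin n,
      (Matrix.of fun p q : Fin m => k (midpt n (x p), midpt n (x q))).det)) (matR k n).det := by
  rw [matR_eq]
  convert hasSum_det_one_add ((1 / (n : ℝ)) • Matrix.of fun i j => k (midpt n i, midpt n j))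
    using 4 with m
  rw [Finset.mul_sum]
  refine Finset.sum_congr rfl fun x _ => ?_
  rw [Matrix.submatrix_smul, Pi.smul_apply, Pi.smul_apply, Matrix.det_smul, Fintype.card_fin]
  rfl

/-- The Nyström determinants converge to the Fredholm determinant. -/
theorem tendsto_det_matR (k : C(I × I, ℝ)) :
    Tendsto (fun n : ℕ => (matR k n).det) atTop (𝓝 (fredholmDet k)) := by
  simp_rw [fun n => (hasSum_det_matR k n).tsum_eq.symm]
  -- Termwise Riemann-sum convergence, dominated by the Hadamard bound, which does not depend on
  -- `n`.
  refine tendsto_tsum_of_dominated_convergence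
    (summable_hadamard_bound ‖k‖ (norm_nonneg k)) (fun m => ?_) (Eventually.of_forall fun n m => ?_)
  · exact (tendsto_riemannSum_pi (continuous_det_kernel k m)).const_mul _
  · rw [Real.norm_eq_abs, abs_mul, abs_of_nonneg (by positivity : (0 : ℝ) ≤ 1 / (m.factorial : ℝ))]
    gcongr
    rw [abs_mul, abs_of_nonneg (by positivity : (0 : ℝ) ≤ (1 / (n : ℝ)) ^ m)]
    calc (1 / (n : ℝ)) ^ m * |∑ x : Fin m → Fin n,
          (Matrix.of fun p q : Fin m => k (midpt n (x p), midpt n (x q))).det|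
        ≤ (1 / (n : ℝ)) ^ m * ∑ _x : Fin m → Fin n, (‖k‖ * √m) ^ m := by
          gcongr
          refine (Finset.abs_sum_le_sum_abs _ _).trans (Finset.sum_le_sum fun x _ => ?_)
          exact abs_det_kernel_le k fun p => midpt n (x p)
      _ = (1 / (n : ℝ) * n) ^ m * (‖k‖ * √m) ^ m := by
          simp only [Finset.sum_const, Finset.card_univ, Fintype.card_fun, Fintype.card_fin,
            nsmul_eq_mul, Nat.cast_pow, mul_pow]
          ring
      _ ≤ 1 * (‖k‖ * √m) ^ m := by
          gcongr
          refine pow_le_one₀ (by positivity) ?_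
          -- Only an inequality is available: at `n = 0` the product `1 / n * n` is `0`.
          rw [one_div]
          exact inv_mul_le_one
      _ = _ := one_mul _

theorem isHermitian_matR {k : C(I × I, ℝ)} (hsymm : ∀ s t, k (s, t) = k (t, s)) (n : ℕ) :
    (matR k n).IsHermitian := by
  ext i j
  simp [matR, hsymm (midpt n i) (midpt n j), eq_comm]

/-- The factor `1 / n` offsets the `n` diagonal terms in the trace of `R_n - 1` and the `n²`
products in that of its square, so the bound is free of `n`. -/
theorem exp_le_det_matR {k : C(I × I, ℝ)} (hsymm : ∀ s t, k (s, t) = k (t, s)) {n : ℕ} {c : ℝ}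
    (hc : 0 < c) (hcoer : ∀ v : Fin n → ℝ, c * (v ⬝ᵥ v) ≤ v ⬝ᵥ (matR k n).mulVec v) :
    Real.exp (-‖k‖ - c⁻¹ * ‖k‖ ^ 2) ≤ (matR k n).det := by
  refine le_trans ?_ (exp_le_det_of_coercive (isHermitian_matR hsymm n) hc hcoer)
  have hsub : matR k n - 1 = (1 / (n : ℝ)) • Matrix.of fun i j => k (midpt n i, midpt n j) := by
    rw [matR_eq, add_sub_cancel_left]
  have hn1 : 1 / (n : ℝ) * n ≤ 1 := by rw [one_div]; exact inv_mul_le_one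
  have hn0 : 0 ≤ 1 / (n : ℝ) * n := by positivity
  have h1 : -‖k‖ ≤ (matR k n - 1).trace := by
    rw [hsub, Matrix.trace_smul, smul_eq_mul]
    have : -(n * ‖k‖) ≤ (Matrix.of fun i j : Fin n => k (midpt n i, midpt n j)).trace := by
      have h : ∑ _i : Fin n, -‖k‖ ≤ ∑ i : Fin n, k (midpt n i, midpt n i) :=
        Finset.sum_le_sum fun i _ => (abs_le.1 (abs_kernel_le k _)).1
      simpa [Matrix.trace] using h
    have h2 := mul_le_mul_of_nonneg_left this (by positivity : 0 ≤ 1 / (n : ℝ))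
    have h3 : (1 / (n : ℝ) * n) * ‖k‖ ≤ 1 * ‖k‖ := by gcongr
    linarith
  have h2 : ((matR k n - 1) * (matR k n - 1)).trace ≤ ‖k‖ ^ 2 := by
    rw [hsub, Matrix.trace]
    have : ∀ i j : Fin n, (1 / (n : ℝ) * k (midpt n i, midpt n j)) *
        (1 / (n : ℝ) * k (midpt n j, midpt n i)) ≤ (1 / (n : ℝ)) ^ 2 * ‖k‖ ^ 2 := by
      intro i j
      rw [hsymm (midpt n j)]
      have : k (midpt n i, midpt n j) ^ 2 ≤ ‖k‖ ^ 2 := sq_le_sq.2 (by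
        rw [abs_of_nonneg (norm_nonneg k)]; exact abs_kernel_le k _)
      calc _ = (1 / (n : ℝ)) ^ 2 * k (midpt n i, midpt n j) ^ 2 := by ring
        _ ≤ _ := by gcongr
    calc _ = ∑ i : Fin n, ∑ j : Fin n, (1 / (n : ℝ) * k (midpt n i, midpt n j)) *
        (1 / (n : ℝ) * k (midpt n j, midpt n i)) := by
          simp only [Matrix.diag_apply, Matrix.mul_apply, Matrix.smul_apply, Matrix.of_apply,
            smul_eq_mul]
      _ ≤ ∑ _i : Fin n, ∑ _j : Fin n, (1 / (n : ℝ)) ^ 2 * ‖k‖ ^ 2 :=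
          Finset.sum_le_sum fun i _ => Finset.sum_le_sum fun j _ => this i j
      _ = (1 / (n : ℝ) * n) ^ 2 * ‖k‖ ^ 2 := by simp; ring
      _ ≤ 1 * ‖k‖ ^ 2 := by
          gcongr
          exact pow_le_one₀ hn0 hn1
      _ = _ := one_mul _
  have h3 : c⁻¹ * ((matR k n - 1) * (matR k n - 1)).trace ≤ c⁻¹ * ‖k‖ ^ 2 := by gcongr
  gcongr

end FredholmDeterminant

/-! ### Transfer between the matrices and the operators. -/

section Discretisation

/-- Half of the coercivity constant pays for the Nyström error. -/
theorem eventually_coercive_matR {k : C(I × I, ℝ)} {c : ℝ} (hc : 0 < c)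
    (h : ∀ f : L2, c * ‖f‖ ^ 2 ≤ inner ℝ f ((1 + intOp k) f)) :
    ∀ᶠ n : ℕ in atTop, ∀ v : Fin n → ℝ, c / 2 * (v ⬝ᵥ v) ≤ v ⬝ᵥ (matR k n).mulVec v := by
  filter_upwards [eventually_norm_one_add_intOp_embed_sub_le k (half_pos hc),
    eventually_gt_atTop 0] with n hn hpos v
  have : NeZero n := ⟨hpos.ne'⟩
  have hn0 : (0 : ℝ) < 1 / n := by positivity
  have h1 := h (embed v)
  have h2 : inner ℝ (embed v) ((1 + intOp k) (embed v)) =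
      inner ℝ (embed v) (embed ((matR k n).mulVec v)) +
        inner ℝ (embed v) ((1 + intOp k) (embed v) - embed ((matR k n).mulVec v)) := by
    rw [← inner_add_right, add_sub_cancel]
  have h3 : inner ℝ (embed v) ((1 + intOp k) (embed v) - embed ((matR k n).mulVec v)) ≤
      c / 2 * ‖embed v‖ ^ 2 := by
    calc _ ≤ ‖embed v‖ * ‖(1 + intOp k) (embed v) - embed ((matR k n).mulVec v)‖ :=
          real_inner_le_norm _ _
      _ ≤ ‖embed v‖ * (c / 2 * ‖embed v‖) := by gcongr; exact hn v
      _ = _ := by ring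
  rw [h2, inner_embed] at h1
  have h4 : ‖embed v‖ ^ 2 = 1 / (n : ℝ) * (v ⬝ᵥ v) := by
    rw [← real_inner_self_eq_norm_sq, inner_embed]
  rw [h4] at h1 h3
  have h5 : 1 / (n : ℝ) * (c / 2 * (v ⬝ᵥ v)) ≤ 1 / (n : ℝ) * (v ⬝ᵥ (matR k n).mulVec v) := by
    linarith
  exact le_of_mul_le_mul_left h5 hn0

theorem posDef_of_coercive {ι : Type*} [Fintype ι] {A : Matrix ι ι ℝ} (hA : A.IsHermitian)
    {c : ℝ} (hc : 0 < c) (h : ∀ v : ι → ℝ, c * (v ⬝ᵥ v) ≤ v ⬝ᵥ A.mulVec v) : A.PosDef := by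
  refine Matrix.PosDef.of_dotProduct_mulVec_pos hA fun v hv => ?_
  have : 0 < v ⬝ᵥ v := by simpa using Matrix.dotProduct_star_self_pos_iff.2 hv
  simpa using (mul_pos hc this).trans_le (h v)

/-- Convergence of the discrete quadratic forms of `R_n⁻¹` to that of `(1 + K)⁻¹`. -/
theorem tendsto_quadForm_matR {k : C(I × I, ℝ)} (u : (L2 →L[ℝ] L2)ˣ) (hu : u.val = 1 + intOp k)
    (hR : ∀ᶠ n : ℕ in atTop, IsUnit (matR k n).det) {w : (n : ℕ) → Fin n → ℝ} {C : ℝ}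
    (hw : ∀ n i, |w n i| ≤ C) :
    Tendsto (fun n : ℕ => 1 / (n : ℝ) * (w n ⬝ᵥ (matR k n)⁻¹.mulVec (w n)) -
      inner ℝ (embed (w n)) (u⁻¹.val (embed (w n)))) atTop (𝓝 0) := by
  -- `n = 1` is the first size that has an entry.
  have hC : 0 ≤ C := (abs_nonneg _).trans (hw 1 0)
  set B : L2 →L[ℝ] L2 := u⁻¹.val
  have hBA : ∀ f, B ((1 + intOp k) f) = f := fun f => by
    rw [← hu]; exact congrArg (fun T : L2 →L[ℝ] L2 => T f) u.inv_mul
  rw [Metric.tendsto_nhds]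
  intro ε hε
  set b : ℝ := ‖B‖ + 1
  have hb : 0 < b := by positivity
  -- The first entry gives `b δ ≤ 1/2`, so `‖embed v‖` can be absorbed; the second makes the final
  -- error at most `ε / 2`, with `+ 1` guarding against `C = 0`.
  set δ : ℝ := min (1 / (2 * b)) (ε / (4 * b ^ 2 * (C ^ 2 + 1)))
  have hδ : 0 < δ := by positivity
  filter_upwards [eventually_norm_one_add_intOp_embed_sub_le k hδ, hR,
    eventually_gt_atTop 0] with n hn hdet hpos
  have : NeZero n := ⟨hpos.ne'⟩
  set v := (matR k n)⁻¹.mulVec (w n)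
  have hv : (matR k n).mulVec v = w n := by
    rw [Matrix.mulVec_mulVec, Matrix.mul_nonsing_inv _ hdet, Matrix.one_mulVec]
  have h1 := hn v
  rw [hv] at h1
  have hwn : ‖embed (w n)‖ ≤ C := norm_embed_le hC (hw n)
  have h2 : ‖embed v - B (embed (w n))‖ ≤ b * (δ * ‖embed v‖) := by
    calc ‖embed v - B (embed (w n))‖ = ‖B ((1 + intOp k) (embed v) - embed (w n))‖ := by
          rw [map_sub, hBA]
      _ ≤ ‖B‖ * ‖(1 + intOp k) (embed v) - embed (w n)‖ := B.le_opNorm _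
      _ ≤ b * (δ * ‖embed v‖) := by gcongr; linarith
  have hbδ : b * δ ≤ 1 / 2 := by
    calc b * δ ≤ b * (1 / (2 * b)) := by gcongr; exact min_le_left _ _
      _ = 1 / 2 := by field_simp
  -- An a priori bound on the discrete solution, obtained from `B` alone without estimating `R_n⁻¹`.
  have h3 : ‖embed v‖ ≤ 2 * (b * C) := by
    have h4 : ‖B (embed (w n))‖ ≤ b * C := (B.le_opNorm _).trans (by gcongr; linarith)
    have h5 : ‖embed v‖ ≤ ‖embed v - B (embed (w n))‖ + ‖B (embed (w n))‖ := by
      simpa using norm_add_le (embed v - B (embed (w n))) (B (embed (w n)))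
    have h6 : b * (δ * ‖embed v‖) ≤ 1 / 2 * ‖embed v‖ := by
      rw [← mul_assoc]; gcongr
    linarith
  rw [← inner_embed, ← inner_sub_right, dist_zero_right]
  calc ‖inner ℝ (embed (w n)) (embed v - B (embed (w n)))‖
      ≤ ‖embed (w n)‖ * ‖embed v - B (embed (w n))‖ := norm_inner_le_norm _ _
    _ ≤ C * (b * (δ * (2 * (b * C)))) := by
        gcongr
        exact h2.trans (by gcongr)
    _ = δ * (2 * b ^ 2 * C ^ 2) := by ring
    _ ≤ ε / (4 * b ^ 2 * (C ^ 2 + 1)) * (2 * b ^ 2 * (C ^ 2 + 1)) := by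
        gcongr
        · exact min_le_right _ _
        · linarith
    _ = ε / 2 := by field_simp; norm_num
    _ < ε := half_lt_self hε

theorem matS_eq_diagonal (D : C(I, ℝ)) (n : ℕ) :
    matS D n = Matrix.diagonal fun i => D (midpt n i) := rfl

theorem matM_eq (D : C(I, ℝ)) (k : C(I × I, ℝ)) (n : ℕ) :
    matM D k n = matS D n * matR k n * matS D n := by
  ext i j
  rw [matS_eq_diagonal, Matrix.mul_diagonal, Matrix.diagonal_mul]
  simp only [matM, matR, Matrix.of_apply]
  split_ifs with h
  · subst h; ring
  · ring

theorem det_matS (D : C(I, ℝ)) (n : ℕ) : (matS D n).det = ∏ i, D (midpt n i) := by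
  rw [matS_eq_diagonal, Matrix.det_diagonal]

theorem det_matS_pos {D : C(I, ℝ)} (hD : ∀ t, 0 < D t) (n : ℕ) : 0 < (matS D n).det := by
  rw [det_matS]
  exact Finset.prod_pos fun i _ => hD _

theorem matS_inv {D : C(I, ℝ)} (hD : ∀ t, 0 < D t) (n : ℕ) :
    (matS D n)⁻¹ = matS (invFun D hD) n := by
  refine Matrix.inv_eq_right_inv ?_
  rw [matS_eq_diagonal, matS_eq_diagonal, Matrix.diagonal_mul_diagonal, ← Matrix.diagonal_one]
  congr 1
  ext i
  exact mul_inv_cancel₀ (hD _).ne'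

/-- No invertibility of `R_n` is needed, since `Matrix.mul_inv_rev` is unconditional; the outer
`S_n⁻¹` moves across because it is diagonal. -/
theorem dotProduct_matM_inv_mulVec {D : C(I, ℝ)} (hD : ∀ t, 0 < D t) (k : C(I × I, ℝ)) {n : ℕ}
    (y : Fin n → ℝ) :
    y ⬝ᵥ (matM D k n)⁻¹.mulVec y = (matS (invFun D hD) n).mulVec y ⬝ᵥ
      (matR k n)⁻¹.mulVec ((matS (invFun D hD) n).mulVec y) := by
  rw [matM_eq, Matrix.mul_inv_rev, Matrix.mul_inv_rev, matS_inv hD, ← Matrix.mulVec_mulVec,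
    ← Matrix.mulVec_mulVec, Matrix.dotProduct_mulVec, ← Matrix.mulVec_transpose, matS_eq_diagonal,
    Matrix.diagonal_transpose]

theorem posDef_matM {D : C(I, ℝ)} (hD : ∀ t, 0 < D t) {k : C(I × I, ℝ)} {n : ℕ}
    (hR : (matR k n).PosDef) : (matM D k n).PosDef := by
  have hS : (matS D n).conjTranspose = matS D n := by
    rw [matS_eq_diagonal, Matrix.diagonal_conjTranspose]; rfl
  have h := hR.conjTranspose_mul_mul_same (B := matS D n)
    (Matrix.mulVec_injective_iff_isUnit.2
      ((Matrix.isUnit_iff_isUnit_det _).2 (det_matS_pos hD n).ne'.isUnit))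
  rwa [hS, ← matM_eq] at h

theorem tendsto_log_det_matS {D : C(I, ℝ)} (hD : ∀ t, 0 < D t) :
    Tendsto (fun n : ℕ => 1 / (n : ℝ) * Real.log (matS D n).det) atTop
      (𝓝 (∫ t, Real.log (D t))) := by
  have h := tendsto_riemannSum (F := fun t => Real.log (D t))
    (D.continuous.log fun t => (hD t).ne')
  simp_rw [det_matS, fun n : ℕ => Real.log_prod (s := Finset.univ)
    (f := fun i : Fin n => D (midpt n i)) fun i _ => (hD _).ne']
  exact h

/-- Sampling a continuous multiplier at the midpoints approximates the multiplication operator. -/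
theorem tendsto_embed_matS_sub_mulOp (E : C(I, ℝ)) {y : (n : ℕ) → Fin n → ℝ} {C : ℝ}
    (hy : ∀ n i, |y n i| ≤ C) :
    Tendsto (fun n : ℕ => embed ((matS E n).mulVec (y n)) - mulOp E (embed (y n))) atTop
      (𝓝 0) := by
  have hC : 0 ≤ C := (abs_nonneg _).trans (hy 1 0)
  rw [Metric.tendsto_nhds]
  intro ε hε
  obtain ⟨N, hN⟩ := exists_forall_dist_le E (ε := ε / (2 * (C + 1))) (by positivity)
  filter_upwards [eventually_ge_atTop N, eventually_gt_atTop 0] with n hn hpos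
  have : NeZero n := ⟨hpos.ne'⟩
  rw [dist_zero_right]
  refine lt_of_le_of_lt (norm_le_of_ae_abs_le (C := ε / (2 * (C + 1)) * (C + 1))
    (by positivity) ?_) ?_
  · filter_upwards [Lp.coeFn_sub (embed ((matS E n).mulVec (y n))) (mulOp E (embed (y n))),
      embed_ae ((matS E n).mulVec (y n)), mulOp_ae E (embed (y n)), embed_ae (y n)]
      with t h1 h2 h3 h4
    rw [h1, Pi.sub_apply, h2, h3, h4, matS_eq_diagonal, Matrix.mulVec_diagonal, ← sub_mul, abs_mul]
    gcongr
    · exact hN n hn _ _ (dist_gridRound_le t)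
    · exact (hy n _).trans (by linarith)
  · rw [div_mul_eq_mul_div, div_lt_iff₀ (by positivity)]
    nlinarith

/-- Expanding with `g = f - d` leaves terms linear and quadratic in `d`, so a bound on `f` alone
suffices. -/
theorem tendsto_inner_clm_sub {E : Type*} [NormedAddCommGroup E] [InnerProductSpace ℝ E]
    (B : E →L[ℝ] E) {f g : ℕ → E} {C : ℝ} (hf : ∀ n, ‖f n‖ ≤ C)
    (h : Tendsto (fun n => f n - g n) atTop (𝓝 0)) :
    Tendsto (fun n => inner ℝ (f n) (B (f n)) - inner ℝ (g n) (B (g n))) atTop (𝓝 0) := by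
  have h0 : Tendsto (fun n => ‖f n - g n‖) atTop (𝓝 0) := by simpa using h.norm
  have hbound : Tendsto (fun n => 2 * C * ‖B‖ * ‖f n - g n‖ + ‖B‖ * ‖f n - g n‖ ^ 2) atTop
      (𝓝 0) := by
    simpa using (h0.const_mul (2 * C * ‖B‖)).add ((h0.pow 2).const_mul ‖B‖)
  refine squeeze_zero_norm (fun n => ?_) hbound
  set d := f n - g n
  have hg : g n = f n - d := (sub_sub_cancel _ _).symm
  have hC : 0 ≤ C := (norm_nonneg _).trans (hf n)
  have hexp : inner ℝ (f n) (B (f n)) - inner ℝ (g n) (B (g n)) =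
      inner ℝ (f n) (B d) + inner ℝ d (B (f n)) - inner ℝ d (B d) := by
    rw [hg, map_sub, inner_sub_left, inner_sub_right, inner_sub_right]
    ring
  have hb : ∀ a c : E, ‖inner ℝ a (B c)‖ ≤ ‖a‖ * (‖B‖ * ‖c‖) := fun a c =>
    (norm_inner_le_norm _ _).trans (by gcongr; exact B.le_opNorm _)
  rw [hexp]
  calc _ ≤ ‖inner ℝ (f n) (B d)‖ + ‖inner ℝ d (B (f n))‖ + ‖inner ℝ d (B d)‖ :=
        (norm_sub_le _ _).trans (by gcongr; exact norm_add_le _ _)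
    _ ≤ C * (‖B‖ * ‖d‖) + ‖d‖ * (‖B‖ * C) + ‖d‖ * (‖B‖ * ‖d‖) := by
        gcongr
        · exact (hb _ _).trans (by gcongr; exact hf n)
        · exact (hb _ _).trans (by gcongr; exact hf n)
        · exact hb _ _
    _ = _ := by ring

/-- Test the positivity of `O` on `D⁻¹ g` and move one `D` across the inner product. -/
theorem inner_one_add_intOp_pos {D : C(I, ℝ)} (hD : ∀ t, 0 < D t) {k : C(I × I, ℝ)}
    (hpos : ∀ f : L2, f ≠ 0 → 0 < inner ℝ f (covOp D k f)) (g : L2) (hg : g ≠ 0) :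
    0 < inner ℝ g ((1 + intOp k) g) := by
  have h1 : mulOp D (mulOp (invFun D hD) g) = g :=
    congrArg (fun T : L2 →L[ℝ] L2 => T g) (mulOp_mul_invFun D hD)
  have h2 : mulOp (invFun D hD) g ≠ 0 := fun h => hg (by rw [← h1, h, map_zero])
  have h3 := hpos _ h2
  have h4 : covOp D k (mulOp (invFun D hD) g) = mulOp D ((1 + intOp k) g) := by
    change mulOp D ((1 + intOp k) (mulOp D (mulOp (invFun D hD) g))) = _
    rw [h1]
  rwa [h4, ← inner_mulOp, h1] at h3

theorem quadForm_eq {D : C(I, ℝ)} (hD : ∀ t, 0 < D t) {k : C(I × I, ℝ)} (u : (L2 →L[ℝ] L2)ˣ)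
    (hu : u.val = 1 + intOp k) (f : L2) :
    quadForm D k f =
      inner ℝ (mulOp (invFun D hD) f) (u⁻¹.val (mulOp (invFun D hD) f)) := by
  have h1 : covOp D k = (mulOpUnit D hD * u * mulOpUnit D hD : (L2 →L[ℝ] L2)ˣ) := by
    rw [Units.val_mul, Units.val_mul, hu]
    rfl
  rw [quadForm, h1, Ring.inverse_unit, inner_mulOp, mul_inv_rev, mul_inv_rev]
  rfl

end Discretisation

end FunctionalLikelihood

end

/-! ### Assembly of the result. -/

theorem mainTheorem1
    (D : C(I, ℝ)) (hD : ∀ t, 0 < D t)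
    (k : C(I × I, ℝ)) (hsymm : ∀ s t, k (s, t) = k (t, s))
    (hpos : ∀ f : L2, f ≠ 0 → 0 < inner ℝ f (covOp D k f))
    (y : (n : ℕ) → Fin n → ℝ) (hy : ∃ C : ℝ, ∀ n i, |y n i| ≤ C) :
    -- `O` has a bounded inverse, the Fredholm series converges to a positive number, and
    -- the matrices `M_n = S_n R_n S_n` are positive definite for all large `n`
    IsUnit (covOp D k) ∧
    Summable (fredholmTerm k) ∧
    0 < fredholmDet k ∧
    (∀ n, matM D k n = matS D n * matR k n * matS D n) ∧
    (∀ᶠ n in atTop, (matM D k n).PosDef) ∧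
    -- equivalence of the log-likelihoods
    Tendsto (fun n : ℕ =>
      1 / (n : ℝ) * (y n ⬝ᵥ ((matM D k n)⁻¹.mulVec (y n)) + Real.log (matM D k n).det)
        - functionalLogLik D k n (embed (y n))) atTop (𝓝 0) ∧
    -- the three convergences in detail
    Tendsto (fun n : ℕ =>
      1 / (n : ℝ) * (y n ⬝ᵥ ((matM D k n)⁻¹.mulVec (y n)))
        - quadForm D k (embed (y n))) atTop (𝓝 0) ∧
    Tendsto (fun n : ℕ => (matR k n).det) atTop (𝓝 (fredholmDet k)) ∧
    Tendsto (fun n : ℕ => Real.log (matR k n).det) atTop (𝓝 (Real.log (fredholmDet k))) ∧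
    Tendsto (fun n : ℕ => 1 / (n : ℝ) * Real.log (matS D n).det) atTop
      (𝓝 (∫ t, Real.log (D t))) := by
  obtain ⟨C, hC⟩ := hy
  have hApos := inner_one_add_intOp_pos hD hpos
  have hAunit := isUnit_one_add_intOp hApos
  obtain ⟨c, hc, hcoer⟩ := exists_coercive_of_isUnit hAunit
    (fun f g => by
      change inner ℝ (f + intOp k f) g = inner ℝ f (g + intOp k g)
      rw [inner_add_left, inner_add_right, inner_intOp_symm hsymm])
    (fun f => by
      rcases eq_or_ne f 0 with rfl | hf
      · simp
      · exact (hApos f hf).le)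
  obtain ⟨u, hu⟩ := hAunit
  have hcR := eventually_coercive_matR hc hcoer
  have hRpos : ∀ᶠ n : ℕ in atTop, (matR k n).PosDef := by
    filter_upwards [hcR] with n hn
    exact posDef_of_coercive (isHermitian_matR hsymm n) (half_pos hc) hn
  have hdet := tendsto_det_matR k
  have hdpos : 0 < fredholmDet k := by
    -- Positivity of each `det R_n` would only give a nonnegative limit; the uniform exponential
    -- bound makes it strict.
    refine (Real.exp_pos (-‖k‖ - (c / 2)⁻¹ * ‖k‖ ^ 2)).trans_le (ge_of_tendsto hdet ?_)
    filter_upwards [hcR] with n hn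
    exact exp_le_det_matR hsymm (half_pos hc) hn
  have hlogR : Tendsto (fun n : ℕ => Real.log (matR k n).det) atTop
      (𝓝 (Real.log (fredholmDet k))) := hdet.log hdpos.ne'
  have hlogS := tendsto_log_det_matS hD
  have hquad : Tendsto (fun n : ℕ => 1 / (n : ℝ) * (y n ⬝ᵥ ((matM D k n)⁻¹.mulVec (y n)))
      - quadForm D k (embed (y n))) atTop (𝓝 0) := by
    have hw : ∀ n i, |(matS (invFun D hD) n).mulVec (y n) i| ≤ ‖invFun D hD‖ * C := fun n i => by
      rw [matS_eq_diagonal, Matrix.mulVec_diagonal, abs_mul]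
      gcongr
      · exact (invFun D hD).norm_coe_le_norm _
      · exact hC n i
    have hw0 : 0 ≤ ‖invFun D hD‖ * C := (abs_nonneg _).trans (hw 1 0)
    have h1 := tendsto_quadForm_matR u hu (hRpos.mono fun n hn => hn.det_pos.ne'.isUnit) hw
    -- `h1` compares matrix and operator at the embedded `S_n⁻¹ y_n`; this replaces that function by
    -- `D⁻¹ f_n`.
    have h2 := tendsto_inner_clm_sub u⁻¹.val (fun n => norm_embed_le hw0 (hw n))
      (tendsto_embed_matS_sub_mulOp (invFun D hD) hC)
    simpa [dotProduct_matM_inv_mulVec hD, quadForm_eq hD u hu] using h1.add h2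
  refine ⟨?_, summable_fredholmTerm k, hdpos, matM_eq D k, ?_, ?_, hquad, hdet, hlogR, hlogS⟩
  · exact ((mulOpUnit D hD).isUnit.mul (hu ▸ u.isUnit)).mul (mulOpUnit D hD).isUnit
  · exact hRpos.mono fun n hn => posDef_matM hD hn
  · have h1 : Tendsto (fun n : ℕ => 1 / (n : ℝ) *
        (Real.log (matR k n).det - Real.log (fredholmDet k))) atTop (𝓝 0) := by
      simpa using tendsto_one_div_atTop_nhds_zero_nat.mul
        (hlogR.sub_const (Real.log (fredholmDet k)))
    have h2 := (hquad.add ((hlogS.sub_const (∫ t, Real.log (D t))).const_mul 2)).add h1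
    simp only [sub_self, mul_zero, add_zero] at h2
    -- The identity is only eventual: splitting the logarithm needs `det R_n ≠ 0`.
    refine h2.congr' ?_
    filter_upwards [hRpos] with n hn
    have hS := (det_matS_pos hD n).ne'
    rw [matM_eq D k n, Matrix.det_mul, Matrix.det_mul,
      Real.log_mul (mul_ne_zero hS hn.det_pos.ne') hS, Real.log_mul hS hn.det_pos.ne', functionalLogLik]
    ring
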